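/- There is no good (in particular, distributability preserving) encoding from the $\pi$-calculus with mixed guarded choice into mixed sessions ($\mathrm{CMV}^+$, untyped). That is, there are no function $[\![\cdot]\!]$ from $\pi$-calculus processes to $\mathrm{CMV}^+$ processes and no equivalence relation $\asymp$ on $\mathrm{CMV}^+$ processes such that $\asymp$ is a weak reduction barbed bisimulation and $[\![\cdot]\!]$ satisfies all the criteria below. *Calculi.* Names form a countably infinite set. The $\pi$-calculus has the processes $P ::= \sum_{i\in I}\alpha_i.P_i \mid (\nu x)P \mid P\,|\,P \mid {!P}$ ($I$ finite) with $\alpha ::= y(x) \mid \overline{y}\langle z\rangle \mid \tau$, and reductions generated by $(\overline{y}\langle z\rangle.P+R)\,|\,(y(x).Q+N)\to P\,|\,Q\{z/x\}$ and $\tau.P+R\to P$. Mixed sessions have the processes $P ::= q\,y\sum_{i\in I}M_i \mid P\,|\,P \mid (\nu yz)P \mid \mathsf{if}\ v\ \mathsf{then}\ P\ \mathsf{else}\ P \mid 0$ with $I$ finite and nonempty, $y\neq z$ the two endpoints of a channel, $q\in\{\mathsf{lin},\mathsf{un}\}$, branches $M ::= \ell!v.P \mid \ell?x.P$, and values $v$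 that are names, booleans or unit. Their reductions are generated by the two rules for conditionals on $\mathsf{true}$ and $\mathsf{false}$ and by $(\nu yz)\big(q\,y(\ell!v.P+M)\,|\,r\,z(\ell?x.Q+N)\,|\,R\big)\to(\nu yz)\big(P\,|\,Q\{v/x\}\,|\,R\,|\,U\big)$, where $U$ is the parallel composition of those of the two reduced choices that are qualified $\mathsf{un}$ (they persist, while $\mathsf{lin}$ choices are consumed). In both calculi reduction is closed under parallel composition, restriction and structural congruence $\equiv$, the least congruence that contains $\alpha$-conversion, the commutative monoid laws for $|$ and $0$, scope extrusion, exchange and garbage collection of restrictions, ${!P}\equiv P\,|\,{!P}$ for the $\pi$-calculus, and $(\nu yz)P\equiv(\nu zy)P$ for mixed sessions; choices are unordered. We write $\Rightarrow$ for the reflexive transitive closure of $\to$. A $\pi$-process has the barb $y$ (resp. $\overline{y}$) if it has an unguarded input (resp. output) on the free name $y$; a mixed-session process has the barb $y$ if it has an unguarded choice on the free endpoint $y$. $P{\Downarrow}\beta$ means that $P\Rightarrow P'$ for some $P'$ with barb $\beta$. A process $P$ is distributable into $P_1,\dots,P_n$ ($n\ge1$) if $P\equiv(\nu\tilde y)(P_1\,|\,\cdots\,|\,P_n)$.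 A weak reduction barbed bisimulation is a relation $\mathcal R$ such that for $(P,Q)\in\mathcal R$ every $P\Rightarrow P'$ is matched by some $Q\Rightarrow Q'$ with $(P',Q')\in\mathcal R$, and conversely, and $P{\Downarrow}\beta$ iff $Q{\Downarrow}\beta$ for all barbs $\beta$. *Criteria* (for all source terms $S,S'$ and target terms $T$): 1. Compositional: for every source operator $\mathit{op}$ and every finite set $N$ of names there is a target context $C$ such that $[\![\mathit{op}(S_1,\dots,S_k)]\!]=C([\![S_1]\!],\dots,[\![S_k]\!])$ whenever the free names of $S_1,\dots,S_k$ together form $N$. 2. Name invariant: $[\![S\sigma]\!]\asymp[\![S]\!]\sigma$ for every substitution $\sigma$ of finitely many names by names. 3. Operationally complete: $S\Rightarrow S'$ implies $[\![S]\!]\Rightarrow\asymp[\![S']\!]$. 4. Operationally sound: $[\![S]\!]\Rightarrow T$ implies that $S\Rightarrow S'$ and $T\Rightarrow\asymp[\![S']\!]$ for some $S'$. 5. Divergence reflecting: if $[\![S]\!]$ has an infinite sequence of steps, then so has $S$. 6. Barb-sensitive: for every name $y$, $S$ reaches a barb on $y$ (that is, $S{\Downarrow}y$ or $S{\Downarrow}\overline{y}$)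 if and only if $[\![S]\!]{\Downarrow}y$. 7. Distributability preserving: if $S$ is distributable into $S_1,\dots,S_n$, then $[\![S]\!]$ is distributable into some $T_1,\dots,T_n$ with $T_i\asymp[\![S_i]\!]$ for all $i$. -/

import Mathlib

namespace MixedSessions

/-! ## Names -/

/-- The countably infinite set of names (they also serve as variables). -/
abbrev Name := ℕ

/-- The labels of branches in mixed sessions. -/
abbrev Label := ℕ

/-- `x` itself if it lies outside `A`, and otherwise some name outside `A`. -/
def pick (x : Name) (A : Finset Name) : Name := if x ∈ A then A.sup id + 1 else x

theorem pick_notMem (x : Name) (A : Finset Name) : pick x A ∉ A := by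
  unfold pick
  split_ifs with h
  · intro h'
    exact Nat.not_succ_le_self _ (Finset.le_sup (f := id) h')
  · exact h

/-! ## The pi-calculus with mixed guarded choice and replication -/

/-- Action prefixes: input `y(x)`, output `y̅⟨z⟩`, and the internal action. -/
inductive PiPrefix : Type
  | inp (y x : Name)
  | out (y z : Name)
  | tau

/-- Processes `∑ i, α i . P i`, `(νx)P`, `P | Q`, `!P`, with raw (named) binders. -/
inductive PiProc : Type
  | sum {n : ℕ} (α : Fin n → PiPrefix) (P : Fin n → PiProc)
  | res (x : Name) (P : PiProc)
  | par (P Q : PiProc)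
  | repl (P : PiProc)

/-- The inactive process is the empty sum. -/
def PiProc.zero : PiProc := .sum (n := 0) (fun i => i.elim0) (fun i => i.elim0)

/-- Free names of `α.P`, where `A` is the set of free names of `P`. -/
def PiPrefix.fnOver (A : Finset Name) : PiPrefix → Finset Name
  | .inp y x => insert y (A.erase x)
  | .out y z => insert y (insert z A)
  | .tau => A

/-- Free names. -/
def PiProc.fn : PiProc → Finset Name
  | .sum α P => Finset.univ.biUnion fun i => (α i).fnOver (P i).fn
  | .res x P => P.fn.erase x
  | .par P Q => P.fn ∪ Q.fn
  | .repl P => P.fn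

/-- The new name of a binder `x` when `σ` is applied to a term `x.P` with `fn P = A`:
`x` is kept if it is not captured, and replaced by a fresh name otherwise. -/
def piAvoid (σ : Name → Name) (x : Name) (A : Finset Name) : Name :=
  pick x ((A.erase x).image σ)

/-- `σ` applied to the prefix `α` of `α.P`, where `A = fn P`. -/
def PiPrefix.subst (σ : Name → Name) (A : Finset Name) : PiPrefix → PiPrefix
  | .inp y x => .inp (σ y) (piAvoid σ x A)
  | .out y z => .out (σ y) (σ z)
  | .tau => .tau

/-- The substitution that acts on `P` when `σ` is applied to `α.P`, where `A = fn P`. -/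
def PiPrefix.under (σ : Name → Name) (A : Finset Name) : PiPrefix → (Name → Name)
  | .inp _ x => Function.update σ x (piAvoid σ x A)
  | .out _ _ => σ
  | .tau => σ

/-- Capture-avoiding simultaneous substitution of names for free names. -/
def PiProc.subst : PiProc → (Name → Name) → PiProc
  | .sum α P, σ =>
      .sum (fun i => (α i).subst σ (P i).fn)
        (fun i => (P i).subst ((α i).under σ (P i).fn))
  | .res x P, σ => .res (piAvoid σ x P.fn) (P.subst (Function.update σ x (piAvoid σ x P.fn)))
  | .par P Q, σ => .par (P.subst σ) (Q.subst σ)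
  | .repl P, σ => .repl (P.subst σ)

/-- `P{z/x}`. -/
def PiProc.subst1 (P : PiProc) (z x : Name) : PiProc := P.subst (Function.update id x z)

/-- Structural congruence: the least congruence that contains alpha-conversion and satisfies
the listed laws; sums are unordered, since they are indexed by a set. -/
inductive PiSC : PiProc → PiProc → Prop
  | refl (P) : PiSC P P
  | symm {P Q} : PiSC P Q → PiSC Q P
  | trans {P Q R} : PiSC P Q → PiSC Q R → PiSC P R
  | congr_sum {n} (α : Fin n → PiPrefix) {P Q : Fin n → PiProc} :
      (∀ i, PiSC (P i) (Q i)) → PiSC (.sum α P) (.sum α Q)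
  | congr_res (x) {P Q} : PiSC P Q → PiSC (.res x P) (.res x Q)
  | congr_par {P P' Q Q'} : PiSC P P' → PiSC Q Q' → PiSC (.par P Q) (.par P' Q')
  | congr_repl {P Q} : PiSC P Q → PiSC (.repl P) (.repl Q)
  | sum_reindex {m n} (e : Fin m ≃ Fin n) (α : Fin n → PiPrefix) (P : Fin n → PiProc) :
      PiSC (.sum (fun i => α (e i)) (fun i => P (e i))) (.sum α P)
  | alpha_res (x x' P) : x' ∉ P.fn.erase x → PiSC (.res x P) (.res x' (P.subst1 x' x))
  | alpha_inp {n} (α : Fin n → PiPrefix) (P : Fin n → PiProc) (i : Fin n) (y x x' : Name) :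
      α i = .inp y x → x' ∉ (P i).fn.erase x →
      PiSC (.sum α P)
        (.sum (Function.update α i (.inp y x')) (Function.update P i ((P i).subst1 x' x)))
  | res_zero (x) : PiSC (.res x .zero) .zero
  | res_comm (x y P) : PiSC (.res x (.res y P)) (.res y (.res x P))
  | par_res (x P Q) : x ∉ P.fn → PiSC (.par P (.res x Q)) (.res x (.par P Q))
  | par_zero (P) : PiSC (.par P .zero) P
  | par_comm (P Q) : PiSC (.par P Q) (.par Q P)
  | par_assoc (P Q R) : PiSC (.par P (.par Q R)) (.par (.par P Q) R)
  | repl (P) : PiSC (.repl P) (.par P (.repl P))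

/-- Reduction. -/
inductive PiStep : PiProc → PiProc → Prop
  | comm {m n} (α : Fin m → PiPrefix) (P : Fin m → PiProc) (β : Fin n → PiPrefix)
      (Q : Fin n → PiProc) (i : Fin m) (j : Fin n) (y z x : Name) :
      α i = .out y z → β j = .inp y x →
      PiStep (.par (.sum α P) (.sum β Q)) (.par (P i) ((Q j).subst1 z x))
  | tau {n} (α : Fin n → PiPrefix) (P : Fin n → PiProc) (i : Fin n) :
      α i = .tau → PiStep (.sum α P) (P i)
  | par {P P'} (Q) : PiStep P P' → PiStep (.par P Q) (.par P' Q)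
  | res (x) {P P'} : PiStep P P' → PiStep (.res x P) (.res x P')
  | struct {P Q Q' P'} : PiSC P Q → PiStep Q Q' → PiSC Q' P' → PiStep P P'

/-- Barbs of the pi-calculus: `inp y` is written `y` and `out y` is written `y̅`. -/
inductive PiBarb : Type
  | inp (y : Name)
  | out (y : Name)

/-- The channel of a barb. -/
def PiBarb.chan : PiBarb → Name
  | .inp y => y
  | .out y => y

/-- The barb that is emitted by an unguarded prefix. -/
def PiPrefix.emits : PiPrefix → PiBarb → Prop
  | .inp y _, b => b = .inp y
  | .out y _, b => b = .out y
  | .tau, _ => False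

/-- `P` has an unguarded prefix with barb `b` on a free channel. -/
def PiProc.barb : PiProc → PiBarb → Prop
  | .sum α _, b => ∃ i, (α i).emits b
  | .res x P, b => P.barb b ∧ b.chan ≠ x
  | .par P Q, b => P.barb b ∨ Q.barb b
  | .repl P, b => P.barb b

/-! ## Mixed sessions (untyped) -/

/-- Values: names, booleans and unit. -/
inductive Val : Type
  | name (x : Name)
  | bool (b : Bool)
  | unit

/-- The qualifier of a choice: linear (used once) or unrestricted (persistent). -/
inductive Qual : Type
  | lin
  | un

/-- Polarity and argument of a branch: `!v` or `?x`, where `x` is bound in the continuation. -/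
inductive Act : Type
  | send (v : Val)
  | recv (x : Name)

/-- Processes `q y ∑ i, l i * a i . P i`, `P | Q`, `(νyz)P`, `if v then P else Q` and `0`,
with raw (named) binders.  A choice has at least one branch, the empty choice is `0`, and the two
endpoints of a channel are different names.  The subject of a choice is a value so that
substitution of values is total; a choice whose subject is not a name is stuck. -/
inductive MixProc : Type
  | choice (q : Qual) (y : Val) {n : ℕ} (l : Fin (n + 1) → Label) (a : Fin (n + 1) → Act)
      (P : Fin (n + 1) → MixProc)
  | par (P Q : MixProc)
  | res (y z : Name) (h : y ≠ z) (P : MixProc)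
  | cond (v : Val) (P Q : MixProc)
  | inact

/-- The names in a value. -/
def Val.fn : Val → Finset Name
  | .name x => {x}
  | .bool _ => ∅
  | .unit => ∅

/-- Free names of a branch whose continuation has free names `A`. -/
def Act.fnOver (A : Finset Name) : Act → Finset Name
  | .send v => v.fn ∪ A
  | .recv x => A.erase x

/-- Free names. -/
def MixProc.fn : MixProc → Finset Name
  | .choice _ y _ a P => y.fn ∪ Finset.univ.biUnion fun i => (a i).fnOver (P i).fn
  | .par P Q => P.fn ∪ Q.fn
  | .res y z _ P => (P.fn.erase y).erase z
  | .cond v P Q => v.fn ∪ P.fn ∪ Q.fn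
  | .inact => ∅

/-- Substitution in a value. -/
def Val.subst (σ : Name → Val) : Val → Val
  | .name x => σ x
  | .bool b => .bool b
  | .unit => .unit

/-- The names that a binder has to avoid when `σ` is applied below it, where `A` is the set
of names that are free below the binder and not bound by it. -/
def captured (σ : Name → Val) (A : Finset Name) : Finset Name := A.biUnion fun x => (σ x).fn

/-- The new name of the input binder `x` of a branch with continuation `P`, where `A = fn P`. -/
def mixAvoid (σ : Name → Val) (x : Name) (A : Finset Name) : Name :=
  pick x (captured σ (A.erase x))

/-- The new name of the first endpoint of `(νyz)P`, where `A = fn P`. -/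
def mixAvoid₁ (σ : Name → Val) (y z : Name) (A : Finset Name) : Name :=
  pick y (captured σ ((A.erase y).erase z))

/-- The new name of the second endpoint of `(νyz)P`, where `A = fn P`. -/
def mixAvoid₂ (σ : Name → Val) (y z : Name) (A : Finset Name) : Name :=
  pick z (insert (mixAvoid₁ σ y z A) (captured σ ((A.erase y).erase z)))

theorem mixAvoid_ne (σ : Name → Val) (y z : Name) (A : Finset Name) :
    mixAvoid₁ σ y z A ≠ mixAvoid₂ σ y z A := by
  intro h
  have := pick_notMem z (insert (mixAvoid₁ σ y z A) (captured σ ((A.erase y).erase z)))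
  rw [Finset.mem_insert, not_or] at this
  exact this.1 h.symm

/-- `σ` applied to the head of a branch whose continuation has free names `A`. -/
def Act.subst (σ : Name → Val) (A : Finset Name) : Act → Act
  | .send v => .send (v.subst σ)
  | .recv x => .recv (mixAvoid σ x A)

/-- The substitution that acts on the continuation (with free names `A`) of a branch. -/
def Act.under (σ : Name → Val) (A : Finset Name) : Act → (Name → Val)
  | .send _ => σ
  | .recv x => Function.update σ x (.name (mixAvoid σ x A))

/-- Capture-avoiding simultaneous substitution of values for free names. -/
def MixProc.subst : MixProc → (Name → Val) → MixProc
  | .choice q y l a P, σ =>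
      .choice q (y.subst σ) l (fun i => (a i).subst σ (P i).fn)
        (fun i => (P i).subst ((a i).under σ (P i).fn))
  | .par P Q, σ => .par (P.subst σ) (Q.subst σ)
  | .res y z _ P, σ =>
      .res (mixAvoid₁ σ y z P.fn) (mixAvoid₂ σ y z P.fn) (mixAvoid_ne σ y z P.fn)
        (P.subst (Function.update (Function.update σ y (.name (mixAvoid₁ σ y z P.fn)))
          z (.name (mixAvoid₂ σ y z P.fn))))
  | .cond v P Q, σ => .cond (v.subst σ) (P.subst σ) (Q.subst σ)
  | .inact, _ => .inact

/-- `P{v/x}`. -/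
def MixProc.subst1 (P : MixProc) (v : Val) (x : Name) : MixProc :=
  P.subst (Function.update Val.name x v)

/-- `P{y'/y, z'/z}` (simultaneously). -/
def MixProc.rename2 (P : MixProc) (y z y' z' : Name) : MixProc :=
  P.subst (Function.update (Function.update Val.name y (.name y')) z (.name z'))

/-- Structural congruence: the least congruence that contains alpha-conversion and satisfies
the listed laws; choices are unordered.  As usual two adjacent restrictions are exchanged only
if they bind different names. -/
inductive MixSC : MixProc → MixProc → Prop
  | refl (P) : MixSC P P
  | symm {P Q} : MixSC P Q → MixSC Q P
  | trans {P Q R} : MixSC P Q → MixSC Q R → MixSC P R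
  | congr_choice (q y) {n} (l : Fin (n + 1) → Label) (a : Fin (n + 1) → Act)
      {P Q : Fin (n + 1) → MixProc} :
      (∀ i, MixSC (P i) (Q i)) → MixSC (.choice q y l a P) (.choice q y l a Q)
  | congr_par {P P' Q Q'} : MixSC P P' → MixSC Q Q' → MixSC (.par P Q) (.par P' Q')
  | congr_res (y z h) {P Q} : MixSC P Q → MixSC (.res y z h P) (.res y z h Q)
  | congr_cond (v) {P P' Q Q'} : MixSC P P' → MixSC Q Q' → MixSC (.cond v P Q) (.cond v P' Q')
  | choice_reindex (q y) {m n} (e : Fin (m + 1) ≃ Fin (n + 1)) (l : Fin (n + 1) → Label)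
      (a : Fin (n + 1) → Act) (P : Fin (n + 1) → MixProc) :
      MixSC (.choice q y (fun i => l (e i)) (fun i => a (e i)) (fun i => P (e i)))
        (.choice q y l a P)
  | alpha_res (y z h y' z' h' P) :
      y' ∉ (P.fn.erase y).erase z → z' ∉ (P.fn.erase y).erase z →
      MixSC (.res y z h P) (.res y' z' h' (P.rename2 y z y' z'))
  | alpha_recv (q y) {n} (l : Fin (n + 1) → Label) (a : Fin (n + 1) → Act)
      (P : Fin (n + 1) → MixProc) (i : Fin (n + 1)) (x x' : Name) :
      a i = .recv x → x' ∉ (P i).fn.erase x →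
      MixSC (.choice q y l a P)
        (.choice q y l (Function.update a i (.recv x'))
          (Function.update P i ((P i).subst1 (.name x') x)))
  | res_inact (y z h) : MixSC (.res y z h .inact) .inact
  | res_comm (y z h y' z' h' P) : y ≠ y' → y ≠ z' → z ≠ y' → z ≠ z' →
      MixSC (.res y z h (.res y' z' h' P)) (.res y' z' h' (.res y z h P))
  | par_res (y z h P Q) : y ∉ P.fn → z ∉ P.fn →
      MixSC (.par P (.res y z h Q)) (.res y z h (.par P Q))
  | res_swap (y z h P) : MixSC (.res y z h P) (.res z y h.symm P)
  | par_inact (P) : MixSC (.par P .inact) P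
  | par_comm (P Q) : MixSC (.par P Q) (.par Q P)
  | par_assoc (P Q R) : MixSC (.par P (.par Q R)) (.par (.par P Q) R)

/-- What remains of a choice `C` besides the chosen continuation when it is reduced:
nothing if it is linear, and the choice itself if it is unrestricted. -/
def Qual.residue (C : MixProc) : Qual → MixProc
  | .lin => .inact
  | .un => C

/-- Reduction.  In `comm` an output on one endpoint of a channel and an input with the same label
on the other endpoint communicate, under the restriction that binds the two endpoints. -/
inductive MixStep : MixProc → MixProc → Prop
  | comm (y z : Name) (h : y ≠ z) (q r : Qual) {m n}
      (l : Fin (m + 1) → Label) (a : Fin (m + 1) → Act) (P : Fin (m + 1) → MixProc)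
      (k : Fin (n + 1) → Label) (b : Fin (n + 1) → Act) (Q : Fin (n + 1) → MixProc)
      (R : MixProc) (i : Fin (m + 1)) (j : Fin (n + 1)) (v : Val) (x : Name) :
      a i = .send v → b j = .recv x → l i = k j →
      MixStep
        (.res y z h (.par (.par (.choice q (.name y) l a P) (.choice r (.name z) k b Q)) R))
        (.res y z h
          (.par (.par (.par (P i) (q.residue (.choice q (.name y) l a P)))
            (.par ((Q j).subst1 v x) (r.residue (.choice r (.name z) k b Q)))) R))
  | cond_true (P Q) : MixStep (.cond (.bool true) P Q) P
  | cond_false (P Q) : MixStep (.cond (.bool false) P Q) Q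
  | par {P P'} (Q) : MixStep P P' → MixStep (.par P Q) (.par P' Q)
  | res (y z h) {P P'} : MixStep P P' → MixStep (.res y z h P) (.res y z h P')
  | struct {P Q Q' P'} : MixSC P Q → MixStep Q Q' → MixSC Q' P' → MixStep P P'

/-- `P` has an unguarded choice on the free channel endpoint `x`. -/
def MixProc.barb : MixProc → Name → Prop
  | .choice _ y _ _ _, x => y = .name x
  | .par P Q, x => P.barb x ∨ Q.barb x
  | .res y z _ P, x => P.barb x ∧ x ≠ y ∧ x ≠ z
  | .cond _ _ _, _ => False
  | .inact, _ => False

/-! ## Calculi and contexts -/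

/-- The data of a calculus that the encodability criteria refer to. -/
structure Calculus where
  /-- the processes -/
  Proc : Type
  /-- the operators of the grammar, with their arguments other than processes -/
  Op : Type
  /-- the number of process arguments of an operator -/
  arity : Op → ℕ
  /-- application of an operator to its process arguments -/
  build : (o : Op) → (Fin (arity o) → Proc) → Proc
  /-- free names -/
  fn : Proc → Finset Name
  /-- capture-avoiding application of a substitution -/
  subst : Proc → (Name → Name) → Proc
  /-- structural congruence -/
  sc : Proc → Proc → Prop
  /-- reduction -/
  step : Proc → Proc → Prop
  /-- observables -/
  Barb : Type
  /-- the channel (endpoint) of an observable -/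
  chan : Barb → Name
  /-- the unguarded observables of a process -/
  barb : Proc → Barb → Prop
  /-- parallel composition -/
  par : Proc → Proc → Proc
  /-- what is bound by one restriction -/
  Binder : Type
  /-- restriction -/
  res : Binder → Proc → Proc

/-- The operators of the pi-calculus; prefixes are parameters of the choice operator. -/
inductive PiOp : Type
  | sum {n : ℕ} (α : Fin n → PiPrefix)
  | res (x : Name)
  | par
  | repl

/-- The number of process arguments. -/
def PiOp.arity : PiOp → ℕ
  | .sum (n := n) _ => n
  | .res _ => 1
  | .par => 2
  | .repl => 1

/-- Application of an operator. -/
def PiOp.build : (o : PiOp) → (Fin o.arity → PiProc) → PiProc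
  | .sum α, P => .sum α P
  | .res x, P => .res x (P (0 : Fin 1))
  | .par, P => .par (P (0 : Fin 2)) (P (1 : Fin 2))
  | .repl, P => .repl (P (0 : Fin 1))

/-- The operators of mixed sessions. -/
inductive MixOp : Type
  | choice (q : Qual) (y : Val) {n : ℕ} (l : Fin (n + 1) → Label) (a : Fin (n + 1) → Act)
  | par
  | res (y z : Name) (h : y ≠ z)
  | cond (v : Val)
  | inact

/-- The number of process arguments. -/
def MixOp.arity : MixOp → ℕ
  | .choice (n := n) _ _ _ _ => n + 1
  | .par => 2
  | .res _ _ _ => 1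
  | .cond _ => 2
  | .inact => 0

/-- Application of an operator. -/
def MixOp.build : (o : MixOp) → (Fin o.arity → MixProc) → MixProc
  | .choice q y l a, P => .choice q y l a P
  | .par, P => .par (P (0 : Fin 2)) (P (1 : Fin 2))
  | .res y z h, P => .res y z h (P (0 : Fin 1))
  | .cond v, P => .cond v (P (0 : Fin 2)) (P (1 : Fin 2))
  | .inact, _ => .inact

/-- The pi-calculus. -/
def piCalculus : Calculus where
  Proc := PiProc
  Op := PiOp
  arity := PiOp.arity
  build := PiOp.build
  fn := PiProc.fn
  subst := PiProc.subst
  sc := PiSC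
  step := PiStep
  Barb := PiBarb
  chan := PiBarb.chan
  barb := PiProc.barb
  par := .par
  Binder := Name
  res := .res

/-- Mixed sessions. -/
def mixCalculus : Calculus where
  Proc := MixProc
  Op := MixOp
  arity := MixOp.arity
  build := MixOp.build
  fn := MixProc.fn
  subst P σ := P.subst fun x => .name (σ x)
  sc := MixSC
  step := MixStep
  Barb := Name
  chan := id
  barb := MixProc.barb
  par := .par
  Binder := {p : Name × Name // p.1 ≠ p.2}
  res p P := .res p.1.1 p.1.2 p.2 P

namespace Calculus

variable (L : Calculus)

/-- Contexts with holes numbered by `Fin k`: terms over the operators and the holes. -/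
inductive Ctx (k : ℕ) : Type
  | hole (i : Fin k)
  | op (o : L.Op) (args : Fin (L.arity o) → Ctx k)

/-- Filling the holes (free names of the arguments may be captured). -/
def Ctx.fill {L : Calculus} {k : ℕ} (T : Fin k → L.Proc) : Ctx L k → L.Proc
  | .hole i => T i
  | .op o args => L.build o fun i => (args i).fill T

/-- Reflexive and transitive closure of reduction. -/
def Steps : L.Proc → L.Proc → Prop := Relation.ReflTransGen L.step

/-- `P` has an infinite sequence of steps. -/
def Diverges (P : L.Proc) : Prop :=
  ∃ f : ℕ → L.Proc, f 0 = P ∧ ∀ i, L.step (f i) (f (i + 1))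

/-- `P` reaches the barb `b`. -/
def WeakBarb (P : L.Proc) (b : L.Barb) : Prop := ∃ P', L.Steps P P' ∧ L.barb P' b

/-- `P` reaches some barb on the channel (endpoint) `y`. -/
def WeakBarbOn (P : L.Proc) (y : Name) : Prop := ∃ b, L.chan b = y ∧ L.WeakBarb P b

/-- Weak reduction, barbed bisimulations. -/
structure IsBisimulation (R : L.Proc → L.Proc → Prop) : Prop where
  left : ∀ P Q, R P Q → ∀ P', L.Steps P P' → ∃ Q', L.Steps Q Q' ∧ R P' Q'
  right : ∀ P Q, R P Q → ∀ Q', L.Steps Q Q' → ∃ P', L.Steps P P' ∧ R P' Q'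
  barb : ∀ P Q, R P Q → ∀ b, L.WeakBarb P b ↔ L.WeakBarb Q b

/-- `P₁ | (P₂ | ⋯)`. -/
def parAll : L.Proc → List L.Proc → L.Proc
  | P, [] => P
  | P, Q :: Qs => L.par P (parAll Q Qs)

/-- `(ν b₁) ⋯ (ν bₘ) P`. -/
def resAll (bs : List L.Binder) (P : L.Proc) : L.Proc := bs.foldr L.res P

/-- `P` is distributable into `P₁, …, Pₙ` with `n ≥ 1`, that is,
`P ≡ (ν b₁) ⋯ (ν bₘ) (P₁ | ⋯ | Pₙ)` for some restrictions. -/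
def Distributable (P : L.Proc) (Ps : List L.Proc) : Prop :=
  ∃ (bs : List L.Binder) (Q : L.Proc) (Qs : List L.Proc),
    Ps = Q :: Qs ∧ L.sc P (L.resAll bs (L.parAll Q Qs))

end Calculus

/-! ## Encodability criteria -/

/-- `enc` is a good encoding of the calculus `L` into the calculus `M` with respect to the
relation `E` on target terms. -/
structure IsGoodEncoding (L M : Calculus) (enc : L.Proc → M.Proc)
    (E : M.Proc → M.Proc → Prop) : Prop where
  equivalence : Equivalence E
  bisimulation : M.IsBisimulation E
  /-- The translation of an operator is a context, applied to the translations of its arguments;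
  the context may depend on the set of free names of the arguments. -/
  compositional : ∀ (o : L.Op) (N : Finset Name), ∃ C : M.Ctx (L.arity o),
    ∀ S : Fin (L.arity o) → L.Proc, (Finset.univ.biUnion fun i => L.fn (S i)) = N →
      enc (L.build o S) = C.fill fun i => enc (S i)
  name_invariant : ∀ (S : L.Proc) (σ : Name → Name), {x | σ x ≠ x}.Finite →
    E (enc (L.subst S σ)) (M.subst (enc S) σ)
  complete : ∀ S S', L.Steps S S' → ∃ T, M.Steps (enc S) T ∧ E T (enc S')
  sound : ∀ S T, M.Steps (enc S) T →
    ∃ S' T', L.Steps S S' ∧ M.Steps T T' ∧ E T' (enc S')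
  divergence_reflecting : ∀ S, M.Diverges (enc S) → L.Diverges S
  barb_sensitive : ∀ S y, L.WeakBarbOn S y ↔ M.WeakBarbOn (enc S) y
  distributability_preserving : ∀ S Ss, L.Distributable S Ss →
    ∃ Ts, M.Distributable (enc S) Ts ∧ List.Forall₂ (fun T S' => E T (enc S')) Ts Ss

end MixedSessions

namespace MixedSessions

/-! In mixed sessions the two parties of a communication use two distinct endpoints bound by a
common restriction, whereas in the pi-calculus they share a name that may be free. Identifying free
names can therefore create a communication in the source, but never in the target.

The witness is `unconnected`. It is stuck and never shows a barb on `3`, but after `1` is replaced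
by `0` it steps and shows one. By barb sensitivity the translation of the substituted term reaches
the barb `3`; by name invariance and the barb clause of the bisimulation, so does the substituted
translation of `unconnected`. `weakBarb_of_subst` pulls this barb back through the substitution, and
since `3` is its own only preimage, the translation of `unconnected` reaches `3` itself. Barb
sensitivity now contradicts `not_weakBarbOn_unconnected`.

The work lies in pulling back. Literal substitution does not commute with raw binders, so processes
are compared by `MixProc.Rel ρ`, alpha-equivalence with free names matched by an arbitrary relation
`ρ`. With `ρ` the graph of the substitution, `MixSC.follows` lets the original imitate structural
congruences and `MixStep.reflect` lets it imitate reductions. On the source side, a polarity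
invariant shows that structural congruence cannot uncover a step. -/

/-! ## Source terms without steps -/

/-- The prefix respects an assignment of a polarity (`true` for output) to every channel. -/
def PiPrefix.HasPolarity (ρ : Name → Bool) : PiPrefix → Prop
  | .inp y _ => ρ y = false
  | .out y _ => ρ y = true
  | .tau => False

/-- The unguarded prefixes of the process respect an assignment of polarities to channels. -/
def PiProc.Polarized : PiProc → (Name → Bool) → Prop
  | .sum α _, ρ => ∀ i, (α i).HasPolarity ρ
  | .res x P, ρ => ∃ b, P.Polarized (Function.update ρ x b)
  | .par P Q, ρ => P.Polarized ρ ∧ Q.Polarized ρ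
  | .repl P, ρ => P.Polarized ρ

theorem PiProc.Polarized.congr {P : PiProc} : ∀ {ρ ρ' : Name → Bool},
    P.Polarized ρ → (∀ x ∈ P.fn, ρ x = ρ' x) → P.Polarized ρ' := by
  induction P with
  | sum α P ih =>
    intro ρ ρ' h hρ i
    have hi := h i
    have hfn : ∀ x ∈ (α i).fnOver (P i).fn, ρ x = ρ' x := fun x hx =>
      hρ x (Finset.mem_biUnion.2 ⟨i, Finset.mem_univ i, hx⟩)
    cases hα : α i with
    | inp y x => simp_all [PiPrefix.HasPolarity, PiPrefix.fnOver]
    | out y z => simp_all [PiPrefix.HasPolarity, PiPrefix.fnOver]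
    | tau => simp_all [PiPrefix.HasPolarity]
  | res x P ih =>
    rintro ρ ρ' ⟨b, h⟩ hρ
    refine ⟨b, ih h fun a ha => ?_⟩
    by_cases hax : a = x
    · simp [hax]
    · simp [hax, hρ a (Finset.mem_erase.2 ⟨hax, ha⟩)]
  | par P Q ihP ihQ =>
    intro ρ ρ' h hρ
    exact ⟨ihP h.1 fun x hx => hρ x (Finset.mem_union_left _ hx),
      ihQ h.2 fun x hx => hρ x (Finset.mem_union_right _ hx)⟩
  | repl P ih => exact fun h hρ => ih h hρ

theorem PiProc.polarized_congr {P : PiProc} {ρ ρ' : Name → Bool} (h : ∀ x ∈ P.fn, ρ x = ρ' x) :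
    P.Polarized ρ ↔ P.Polarized ρ' :=
  ⟨fun hP => hP.congr h, fun hP => hP.congr fun x hx => (h x hx).symm⟩

theorem PiPrefix.hasPolarity_subst (σ : Name → Name) (A : Finset Name) (ρ : Name → Bool)
    (α : PiPrefix) : (α.subst σ A).HasPolarity ρ ↔ α.HasPolarity (ρ ∘ σ) := by
  cases α <;> rfl

/-- Polarity looks only at the channels of unguarded prefixes, so it pulls back along `σ`. Under a
restriction the new bound name avoids the images of the other free names, so choosing its polarity
does not disturb theirs. -/
theorem PiProc.polarized_subst (P : PiProc) : ∀ (σ : Name → Name) (ρ : Name → Bool),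
    (P.subst σ).Polarized ρ ↔ P.Polarized (ρ ∘ σ) := by
  induction P with
  | sum α P ih =>
    intro σ ρ
    refine forall_congr' fun i => ?_
    rw [PiPrefix.hasPolarity_subst]
  | res x P ih =>
    intro σ ρ
    refine exists_congr fun b => ?_
    rw [ih]
    refine polarized_congr fun a ha => ?_
    by_cases hax : a = x
    · simp [hax]
    · have : σ a ≠ piAvoid σ x P.fn := ne_of_mem_of_not_mem
        (Finset.mem_image_of_mem σ (Finset.mem_erase.2 ⟨hax, ha⟩)) (pick_notMem x _)
      simp [hax, this]
  | par P Q ihP ihQ => exact fun σ ρ => and_congr (ihP σ ρ) (ihQ σ ρ)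
  | repl P ih => exact fun σ ρ => ih σ ρ

/-- Invariance is what makes polarity survive the structural rule of reduction, without any normal
form for processes. -/
theorem PiSC.polarized_iff {P Q : PiProc} (h : PiSC P Q) :
    ∀ ρ, P.Polarized ρ ↔ Q.Polarized ρ := by
  induction h with
  | refl P => exact fun _ => Iff.rfl
  | symm _ ih => exact fun ρ => (ih ρ).symm
  | trans _ _ ih₁ ih₂ => exact fun ρ => (ih₁ ρ).trans (ih₂ ρ)
  | congr_sum α _ _ => exact fun _ => Iff.rfl
  | congr_res x _ ih => exact fun ρ => exists_congr fun b => ih _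
  | congr_par _ _ ih₁ ih₂ => exact fun ρ => and_congr (ih₁ ρ) (ih₂ ρ)
  | congr_repl _ ih => exact ih
  | sum_reindex e α P =>
    exact fun ρ => e.forall_congr_left.trans (by simp [PiProc.Polarized])
  | alpha_res x x' P hx =>
    intro ρ
    refine exists_congr fun b => ?_
    rw [PiProc.subst1, PiProc.polarized_subst]
    refine PiProc.polarized_congr fun a ha => ?_
    by_cases hax : a = x
    · simp [hax]
    · have : a ≠ x' := fun h => hx (h ▸ Finset.mem_erase.2 ⟨hax, ha⟩)
      simp [hax, this]
  | alpha_inp α P i y x x' hα _ =>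
    refine fun ρ => forall_congr' fun j => ?_
    by_cases hj : j = i
    · subst hj
      simp [hα, PiPrefix.HasPolarity]
    · simp [hj]
  | res_zero x => exact fun ρ => ⟨fun _ i => i.elim0, fun _ => ⟨false, fun i => i.elim0⟩⟩
  | res_comm x y P =>
    intro ρ
    by_cases hxy : x = y
    · rw [hxy]
    · simp only [PiProc.Polarized]
      rw [exists_comm]
      simp only [Function.update_comm hxy]
  | par_res x P Q hx =>
    intro ρ
    simp only [PiProc.Polarized, ← exists_and_left]
    refine exists_congr fun b => and_congr_left fun _ => PiProc.polarized_congr fun a ha => ?_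
    have : a ≠ x := fun h => hx (h ▸ ha)
    simp [this]
  | par_zero P => exact fun ρ => and_iff_left fun i => i.elim0
  | par_comm P Q => exact fun ρ => and_comm
  | par_assoc P Q R => exact fun ρ => and_assoc.symm
  | repl P => exact fun ρ => (and_self_iff).symm

/-- A communication has an unguarded output and an unguarded input on one channel, which would need
both polarities; `tau` has none. -/
theorem PiStep.not_polarized {P Q : PiProc} (h : PiStep P Q) : ∀ ρ, ¬ P.Polarized ρ := by
  induction h with
  | comm α P β Q i j y z x hα hβ =>
    rintro ρ ⟨h₁, h₂⟩
    have h₁ := h₁ i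
    have h₂ := h₂ j
    simp_all [PiPrefix.HasPolarity]
  | tau α P i hα =>
    intro ρ h
    have := h i
    simp_all [PiPrefix.HasPolarity]
  | par Q _ ih => exact fun ρ h => ih ρ h.1
  | res x _ ih => exact fun ρ ⟨b, h⟩ => ih _ h
  | struct hs _ _ ih => exact fun ρ h => ih ρ ((hs.polarized_iff ρ).1 h)

/-! ## Alpha-equivalence relative to a relation on names -/

/-- The relation on names below a pair of binders. -/
def extend (ρ : Name → Name → Prop) (x x' : Name) : Name → Name → Prop :=
  fun a b => (a = x ∧ b = x') ∨ (a ≠ x ∧ b ≠ x' ∧ ρ a b)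

/-- Values that agree up to a relation on names. -/
def Val.Rel (ρ : Name → Name → Prop) : Val → Val → Prop
  | .name x, .name y => ρ x y
  | .bool b, .bool c => b = c
  | .unit, .unit => True
  | _, _ => False

/-- Heads of branches that agree up to a relation on names. -/
def Act.Rel (ρ : Name → Name → Prop) : Act → Act → Prop
  | .send v, .send w => v.Rel ρ w
  | .recv _, .recv _ => True
  | _, _ => False

/-- The relation on names in the continuations of two branches. -/
def Act.extend (ρ : Name → Name → Prop) : Act → Act → Name → Name → Prop
  | .recv x, .recv y => MixedSessions.extend ρ x y
  | _, _ => ρ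

/-- Processes that agree up to bound names and up to a relation on free names. -/
inductive MixProc.Rel : (Name → Name → Prop) → MixProc → MixProc → Prop
  | choice {ρ} (q) {y y'} {n} (l : Fin (n + 1) → Label) {a a' : Fin (n + 1) → Act}
      {P P' : Fin (n + 1) → MixProc} : y.Rel ρ y' → (∀ i, (a i).Rel ρ (a' i)) →
      (∀ i, MixProc.Rel ((a i).extend ρ (a' i)) (P i) (P' i)) →
      MixProc.Rel ρ (.choice q y l a P) (.choice q y' l a' P')
  | par {ρ P P' Q Q'} : MixProc.Rel ρ P P' → MixProc.Rel ρ Q Q' →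
      MixProc.Rel ρ (.par P Q) (.par P' Q')
  | res {ρ y z y' z'} (h h') {P P'} : MixProc.Rel (extend (extend ρ y y') z z') P P' →
      MixProc.Rel ρ (.res y z h P) (.res y' z' h' P')
  | cond {ρ v v' P P' Q Q'} : v.Rel ρ v' → MixProc.Rel ρ P P' → MixProc.Rel ρ Q Q' →
      MixProc.Rel ρ (.cond v P Q) (.cond v' P' Q')
  | inact {ρ} : MixProc.Rel ρ .inact .inact

/-! ### Monotonicity, converse and composition of the relation on processes -/

theorem Val.Rel.mono {ρ ρ' : Name → Name → Prop} {v w : Val} (h : v.Rel ρ w)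
    (hρ : ∀ a ∈ v.fn, ∀ b ∈ w.fn, ρ a b → ρ' a b) : v.Rel ρ' w := by
  cases v <;> cases w <;> simp_all [Val.Rel, Val.fn]

theorem extend_mono {ρ ρ' : Name → Name → Prop} {x x' : Name} {A B : Finset Name}
    (hρ : ∀ a ∈ A.erase x, ∀ b ∈ B.erase x', ρ a b → ρ' a b) :
    ∀ a ∈ A, ∀ b ∈ B, extend ρ x x' a b → extend ρ' x x' a b := by
  rintro a ha b hb (h | ⟨h₁, h₂, h₃⟩)
  · exact .inl h
  · exact .inr ⟨h₁, h₂, hρ a (Finset.mem_erase.2 ⟨h₁, ha⟩) b (Finset.mem_erase.2 ⟨h₂, hb⟩) h₃⟩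

theorem MixProc.Rel.mono {ρ : Name → Name → Prop} {P Q : MixProc} (h : P.Rel ρ Q) :
    ∀ {ρ' : Name → Name → Prop}, (∀ a ∈ P.fn, ∀ b ∈ Q.fn, ρ a b → ρ' a b) → P.Rel ρ' Q := by
  induction h with
  | @choice ρ q y y' n l a a' P P' hy ha _ ih =>
    intro ρ' hρ
    have hb : ∀ i, ∀ c ∈ (a i).fnOver (P i).fn, ∀ d ∈ (a' i).fnOver (P' i).fn, ρ c d → ρ' c d :=
      fun i c hc d hd => hρ c
        (Finset.mem_union_right _ (Finset.mem_biUnion.2 ⟨i, Finset.mem_univ i, hc⟩)) d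
        (Finset.mem_union_right _ (Finset.mem_biUnion.2 ⟨i, Finset.mem_univ i, hd⟩))
    refine .choice q l (hy.mono fun c hc d hd => hρ c (Finset.mem_union_left _ hc) d
      (Finset.mem_union_left _ hd)) (fun i => ?_) (fun i => ih i ?_)
    · have h₁ := ha i
      have h₂ := hb i
      revert h₁ h₂
      cases a i <;> cases a' i <;> intro h₁ h₂
      · exact Val.Rel.mono h₁ fun c hc d hd =>
          h₂ c (Finset.mem_union_left _ hc) d (Finset.mem_union_left _ hd)
      all_goals exact h₁
    · have h₁ := ha i
      have h₂ := hb i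
      revert h₁ h₂
      cases a i <;> cases a' i <;> intro h₁ h₂
      · exact fun c hc d hd => h₂ c (Finset.mem_union_right _ hc) d (Finset.mem_union_right _ hd)
      · exact h₁.elim
      · exact h₁.elim
      · exact extend_mono h₂
  | par _ _ ih₁ ih₂ =>
    intro ρ' hρ
    exact .par
      (ih₁ fun a ha b hb => hρ a (Finset.mem_union_left _ ha) b (Finset.mem_union_left _ hb))
      (ih₂ fun a ha b hb => hρ a (Finset.mem_union_right _ ha) b (Finset.mem_union_right _ hb))
  | @res ρ y z y' z' h h' P P' _ ih =>
    intro ρ' hρ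
    refine .res h h' (ih (extend_mono (extend_mono ?_)))
    -- The extension by the second endpoint is outermost and is peeled off first, whereas
    -- `MixProc.fn` erases the first endpoint first.
    simp only [MixProc.fn, Finset.erase_right_comm (a := y), Finset.erase_right_comm (a := y')]
      at hρ
    exact hρ
  | cond hv _ _ ih₁ ih₂ =>
    intro ρ' hρ
    simp only [MixProc.fn, Finset.mem_union] at hρ
    exact .cond (hv.mono fun a ha b hb => hρ a (.inl (.inl ha)) b (.inl (.inl hb)))
      (ih₁ fun a ha b hb => hρ a (.inl (.inr ha)) b (.inl (.inr hb)))
      (ih₂ fun a ha b hb => hρ a (.inr ha) b (.inr hb))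
  | inact => exact fun _ => .inact

theorem Val.Rel.symm {ρ : Name → Name → Prop} {v w : Val} (h : v.Rel ρ w) :
    w.Rel (fun a b => ρ b a) v := by
  cases v <;> cases w <;> simp_all [Val.Rel]

theorem extend_flip (ρ : Name → Name → Prop) (x x' : Name) :
    (fun a b => extend ρ x x' b a) = extend (fun a b => ρ b a) x' x := by
  funext a b
  simp only [extend, eq_iff_iff]
  tauto

theorem MixProc.Rel.symm {ρ : Name → Name → Prop} {P Q : MixProc} (h : P.Rel ρ Q) :
    Q.Rel (fun a b => ρ b a) P := by
  induction h with
  | @choice ρ q y y' n l a a' P P' hy ha _ ih =>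
    refine .choice q l hy.symm (fun i => ?_) (fun i => ?_)
    · have := ha i
      revert this
      cases a i <;> cases a' i <;> intro h
      · exact Val.Rel.symm h
      all_goals exact h
    · have h₁ := ha i
      have h₂ := ih i
      revert h₁ h₂
      cases a i <;> cases a' i <;> intro h₁ h₂
      · exact h₂
      · exact h₁.elim
      · exact h₁.elim
      · simpa only [Act.extend, extend_flip] using h₂
  | par _ _ ih₁ ih₂ => exact .par ih₁ ih₂
  | res h h' _ ih =>
    rw [extend_flip, extend_flip] at ih
    exact .res h' h ih
  | cond hv _ _ ih₁ ih₂ => exact .cond hv.symm ih₁ ih₂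
  | inact => exact .inact

theorem Val.Rel.trans {ρ ρ' : Name → Name → Prop} {u v w : Val} (h : u.Rel ρ v)
    (h' : v.Rel ρ' w) : u.Rel (Relation.Comp ρ ρ') w := by
  cases u <;> cases v <;> cases w <;> simp_all [Val.Rel]
  exact ⟨_, h, h'⟩

/-- Only this inclusion holds: conversely, the intermediate name for a pair of free names might be
the middle binder `y`. This is why composition goes through `MixProc.Rel.mono`. -/
theorem comp_extend {ρ ρ' : Name → Name → Prop} {x y z a b : Name}
    (h : Relation.Comp (extend ρ x y) (extend ρ' y z) a b) :
    extend (Relation.Comp ρ ρ') x z a b := by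
  obtain ⟨c, h₁ | h₁, h₂ | h₂⟩ := h
  · exact .inl ⟨h₁.1, h₂.2⟩
  · exact (h₂.1 h₁.2).elim
  · exact (h₁.2.1 h₂.1).elim
  · exact .inr ⟨h₁.1, h₂.2.1, c, h₁.2.2, h₂.2.2⟩

theorem MixProc.Rel.trans {ρ : Name → Name → Prop} {P Q : MixProc} (h : P.Rel ρ Q) :
    ∀ {ρ' R}, Q.Rel ρ' R → P.Rel (Relation.Comp ρ ρ') R := by
  induction h with
  | @choice ρ q y y' n l a a' P P' hy ha _ ih =>
    intro ρ' R hR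
    cases hR with
    | @choice _ _ _ y'' _ _ _ a'' _ P'' hy' ha' hP' =>
    refine .choice q l (hy.trans hy') (fun i => ?_) (fun i => ?_)
    · have h₁ := ha i
      have h₂ := ha' i
      revert h₁ h₂
      cases a i <;> cases a' i <;> cases a'' i <;> intro h₁ h₂ <;>
        first | exact h₁.elim | exact h₂.elim | exact Val.Rel.trans h₁ h₂ | exact trivial
    · have h₁ := ha i
      have h₂ := ha' i
      refine (ih i (hP' i)).mono fun c _ d _ => ?_
      revert h₁ h₂
      cases a i <;> cases a' i <;> cases a'' i <;> intro h₁ h₂ <;>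
        first | exact h₁.elim | exact h₂.elim | exact id | exact comp_extend
  | par _ _ ih₁ ih₂ =>
    intro ρ' R hR
    cases hR with
    | par h₁ h₂ => exact .par (ih₁ h₁) (ih₂ h₂)
  | res h h' _ ih =>
    intro ρ' R hR
    cases hR with
    -- Two nested extensions are composed: `comp_extend` handles the outer one, and `extend_mono` on
    -- singletons applies it again inside.
    | res _ h'' hP => exact .res h h'' ((ih hP).mono fun a _ b _ hab =>
        extend_mono (A := {a}) (B := {b}) (fun _ _ _ _ => comp_extend) a (by simp) b (by simp)
          (comp_extend hab))
  | cond hv _ _ ih₁ ih₂ =>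
    intro ρ' R hR
    cases hR with
    | cond hv' h₁ h₂ => exact .cond (hv.trans hv') (ih₁ h₁) (ih₂ h₂)
  | inact =>
    intro ρ' R hR
    cases hR
    exact .inact

theorem extend_eq (x : Name) : extend Eq x x = Eq := by
  funext a b
  simp only [extend, eq_iff_iff]
  constructor
  · rintro (⟨rfl, rfl⟩ | ⟨_, _, h⟩)
    · rfl
    · exact h
  · rintro rfl
    by_cases h : a = x <;> simp [h]

theorem Val.Rel.refl (v : Val) : v.Rel Eq v := by
  cases v <;> simp [Val.Rel]

theorem MixProc.Rel.refl (P : MixProc) : P.Rel Eq P := by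
  induction P with
  | choice q y l a P ih =>
    refine .choice q l (Val.Rel.refl y) (fun i => ?_) (fun i => ?_)
    · cases a i
      · exact Val.Rel.refl _
      · trivial
    · cases a i
      · exact ih i
      · simpa only [Act.extend, extend_eq] using ih i
  | par P Q ihP ihQ => exact .par ihP ihQ
  | res y z h P ih => exact .res h h (by simpa only [extend_eq] using ih)
  | cond v P Q ihP ihQ => exact .cond (Val.Rel.refl v) ihP ihQ
  | inact => exact .inact

/-- Each free occurrence on the left has a partner at the same position on the right. This transfers
the side conditions of scope extrusion. -/
theorem MixProc.Rel.exists_fn_right {ρ : Name → Name → Prop} {P Q : MixProc} (h : P.Rel ρ Q) :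
    ∀ a ∈ P.fn, ∃ b ∈ Q.fn, ρ a b := by
  have val : ∀ {ρ : Name → Name → Prop} {v w : Val}, v.Rel ρ w →
      ∀ a ∈ v.fn, ∃ b ∈ w.fn, ρ a b := by
    intro ρ v w h
    cases v <;> cases w <;> simp_all [Val.Rel, Val.fn]
  have ext : ∀ {ρ : Name → Name → Prop} {x x' : Name} {A B : Finset Name},
      (∀ a ∈ A, ∃ b ∈ B, extend ρ x x' a b) → ∀ a ∈ A.erase x, ∃ b ∈ B.erase x', ρ a b := by
    intro ρ x x' A B h a ha
    rw [Finset.mem_erase] at ha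
    obtain ⟨b, hb, h | h⟩ := h a ha.2
    · exact (ha.1 h.1).elim
    · exact ⟨b, Finset.mem_erase.2 ⟨h.2.1, hb⟩, h.2.2⟩
  induction h with
  | @choice ρ q y y' n l a a' P P' hy ha _ ih =>
    intro c hc
    rcases Finset.mem_union.1 hc with hc | hc
    · obtain ⟨d, hd, h⟩ := val hy c hc
      exact ⟨d, Finset.mem_union_left _ hd, h⟩
    · obtain ⟨i, _, hc⟩ := Finset.mem_biUnion.1 hc
      suffices ∃ d ∈ (a' i).fnOver (P' i).fn, ρ c d by
        obtain ⟨d, hd, h⟩ := this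
        exact ⟨d, Finset.mem_union_right _ (Finset.mem_biUnion.2 ⟨i, Finset.mem_univ i, hd⟩), h⟩
      have h₁ := ha i
      have h₂ := ih i
      revert h₁ h₂ hc
      cases a i <;> cases a' i <;> intro hc h₁ h₂
      · rcases Finset.mem_union.1 hc with hc | hc
        · obtain ⟨d, hd, h⟩ := val h₁ c hc
          exact ⟨d, Finset.mem_union_left _ hd, h⟩
        · obtain ⟨d, hd, h⟩ := h₂ c hc
          exact ⟨d, Finset.mem_union_right _ hd, h⟩
      · exact h₁.elim
      · exact h₁.elim
      · exact ext h₂ c hc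
  | par _ _ ih₁ ih₂ =>
    intro a ha
    rcases Finset.mem_union.1 ha with ha | ha
    · obtain ⟨b, hb, h⟩ := ih₁ a ha
      exact ⟨b, Finset.mem_union_left _ hb, h⟩
    · obtain ⟨b, hb, h⟩ := ih₂ a ha
      exact ⟨b, Finset.mem_union_right _ hb, h⟩
  | @res ρ y z y' z' h h' P P' _ ih =>
    intro a ha
    rw [MixProc.fn, Finset.erase_right_comm] at ha ⊢
    exact ext (ext ih) a ha
  | cond hv _ _ ih₁ ih₂ =>
    intro a ha
    simp only [MixProc.fn, Finset.mem_union] at ha ⊢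
    rcases ha with (ha | ha) | ha
    · obtain ⟨b, hb, h⟩ := val hv a ha
      exact ⟨b, .inl (.inl hb), h⟩
    · obtain ⟨b, hb, h⟩ := ih₁ a ha
      exact ⟨b, .inl (.inr hb), h⟩
    · obtain ⟨b, hb, h⟩ := ih₂ a ha
      exact ⟨b, .inr hb, h⟩
  | inact => simp [MixProc.fn]

/-! ## Substitution -/

theorem Val.Rel.subst {ρ ρ' : Name → Name → Prop} {σ τ : Name → Val} {v w : Val}
    (h : v.Rel ρ' w) (hσ : ∀ a ∈ v.fn, ∀ b ∈ w.fn, ρ' a b → (σ a).Rel ρ (τ b)) :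
    (v.subst σ).Rel ρ (w.subst τ) := by
  cases v <;> cases w <;> simp_all [Val.Rel, Val.fn, Val.subst]

/-- The binder case of substitution: since the new binders occur in no image of another free name,
related images remain related below them. -/
theorem extend_subst {ρ ρ' : Name → Name → Prop} {σ τ : Name → Val} {x x' y y' : Name}
    {A B : Finset Name} (hy : y ∉ captured σ (A.erase x)) (hy' : y' ∉ captured τ (B.erase x'))
    (hσ : ∀ a ∈ A.erase x, ∀ b ∈ B.erase x', ρ' a b → (σ a).Rel ρ (τ b)) :
    ∀ a ∈ A, ∀ b ∈ B, extend ρ' x x' a b →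
      (Function.update σ x (.name y) a).Rel (extend ρ y y')
        (Function.update τ x' (.name y') b) := by
  rintro a ha b hb (⟨rfl, rfl⟩ | ⟨h₁, h₂, h₃⟩)
  · simp [Val.Rel, extend]
  · have ha' := Finset.mem_erase.2 ⟨h₁, ha⟩
    have hb' := Finset.mem_erase.2 ⟨h₂, hb⟩
    rw [Function.update_of_ne h₁, Function.update_of_ne h₂]
    refine (hσ a ha' b hb' h₃).mono fun c hc d hd hcd => .inr ⟨?_, ?_, hcd⟩
    · rintro rfl
      exact hy (Finset.mem_biUnion.2 ⟨a, ha', hc⟩)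
    · rintro rfl
      exact hy' (Finset.mem_biUnion.2 ⟨b, hb', hd⟩)

/-- The endpoints of a restriction are treated as two successive binders. The second new name must
then avoid the first one too, which `mixAvoid₂` ensures by its `insert`. -/
theorem captured_update_erase {σ : Name → Val} {y z x : Name} {A : Finset Name}
    (hx : x ∉ captured σ ((A.erase y).erase z)) {y' : Name} (hy' : x ≠ y') :
    x ∉ captured (Function.update σ y (.name y')) (A.erase z) := by
  simp only [captured, Finset.mem_biUnion, Finset.mem_erase, not_exists, not_and] at hx ⊢
  rintro a ⟨h₁, h₂⟩
  by_cases hay : a = y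
  · subst hay
    simpa [Val.fn] using hy'
  · rw [Function.update_of_ne hay]
    exact hx a ⟨h₁, hay, h₂⟩

/-- The two sides may carry different substitutions and rename their binders differently. Only the
images of related free names have to match. -/
theorem MixProc.Rel.subst {ρ' : Name → Name → Prop} {P Q : MixProc} (h : P.Rel ρ' Q) :
    ∀ {ρ : Name → Name → Prop} {σ τ : Name → Val},
      (∀ a ∈ P.fn, ∀ b ∈ Q.fn, ρ' a b → (σ a).Rel ρ (τ b)) →
      (P.subst σ).Rel ρ (Q.subst τ) := by
  induction h with
  | @choice ρ' q y y' n l a a' P P' hy ha _ ih =>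
    intro ρ σ τ hσ
    have hb : ∀ i, ∀ c ∈ (a i).fnOver (P i).fn, ∀ d ∈ (a' i).fnOver (P' i).fn,
        ρ' c d → (σ c).Rel ρ (τ d) :=
      fun i c hc d hd => hσ c
        (Finset.mem_union_right _ (Finset.mem_biUnion.2 ⟨i, Finset.mem_univ i, hc⟩)) d
        (Finset.mem_union_right _ (Finset.mem_biUnion.2 ⟨i, Finset.mem_univ i, hd⟩))
    refine .choice q l (hy.subst fun c hc d hd => hσ c (Finset.mem_union_left _ hc) d
      (Finset.mem_union_left _ hd)) (fun i => ?_) (fun i => ih i ?_)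
    · have h₁ := ha i
      have h₂ := hb i
      revert h₁ h₂
      cases a i <;> cases a' i <;> intro h₁ h₂
      · exact Val.Rel.subst h₁ fun c hc d hd =>
          h₂ c (Finset.mem_union_left _ hc) d (Finset.mem_union_left _ hd)
      all_goals exact h₁
    · have h₁ := ha i
      have h₂ := hb i
      revert h₁ h₂
      cases a i <;> cases a' i <;> intro h₁ h₂
      · exact fun c hc d hd => h₂ c (Finset.mem_union_right _ hc) d (Finset.mem_union_right _ hd)
      · exact h₁.elim
      · exact h₁.elim
      · exact extend_subst (pick_notMem _ _) (pick_notMem _ _) h₂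
  | par _ _ ih₁ ih₂ =>
    intro ρ σ τ hσ
    exact .par
      (ih₁ fun a ha b hb => hσ a (Finset.mem_union_left _ ha) b (Finset.mem_union_left _ hb))
      (ih₂ fun a ha b hb => hσ a (Finset.mem_union_right _ ha) b (Finset.mem_union_right _ hb))
  | @res ρ' y z y' z' h h' P P' _ ih =>
    intro ρ σ τ hσ
    have avoid : ∀ (σ : Name → Val) (y z : Name) (A : Finset Name),
        mixAvoid₂ σ y z A ∉ captured (Function.update σ y (.name (mixAvoid₁ σ y z A)))
          (A.erase z) := fun σ y z A => captured_update_erase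
      (fun h => pick_notMem z (insert (mixAvoid₁ σ y z A) (captured σ ((A.erase y).erase z)))
        (Finset.mem_insert_of_mem h)) (mixAvoid_ne σ y z A).symm
    refine .res _ _ (ih (extend_subst (avoid _ _ _ _) (avoid _ _ _ _)
      (extend_subst ?_ ?_ ?_)))
    · rw [Finset.erase_right_comm]
      exact pick_notMem _ _
    · rw [Finset.erase_right_comm]
      exact pick_notMem _ _
    · rw [Finset.erase_right_comm (a := z), Finset.erase_right_comm (a := z')]
      exact hσ
  | cond hv _ _ ih₁ ih₂ =>
    intro ρ σ τ hσ
    simp only [MixProc.fn, Finset.mem_union] at hσ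
    exact .cond (hv.subst fun a ha b hb => hσ a (.inl (.inl ha)) b (.inl (.inl hb)))
      (ih₁ fun a ha b hb => hσ a (.inl (.inr ha)) b (.inl (.inr hb)))
      (ih₂ fun a ha b hb => hσ a (.inr ha) b (.inr hb))
  | inact => exact fun _ => .inact

/-! ### The identity substitution and alpha-conversion -/

theorem Val.subst_name (v : Val) : v.subst .name = v := by
  cases v <;> rfl

theorem captured_name (A : Finset Name) : captured .name A = A := by
  ext a
  simp [captured, Val.fn]

theorem pick_of_notMem {x : Name} {A : Finset Name} (h : x ∉ A) : pick x A = x :=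
  if_neg h

/-- This is a literal equality because `pick` keeps a binder that captures nothing. -/
theorem MixProc.subst_name (P : MixProc) : P.subst .name = P := by
  induction P with
  | choice q y l a P ih =>
    have ha : ∀ i, (a i).subst .name (P i).fn = a i ∧ (a i).under .name (P i).fn = .name := by
      intro i
      cases a i with
      | send v => exact ⟨congrArg Act.send v.subst_name, rfl⟩
      | recv x =>
        have hx : mixAvoid .name x (P i).fn = x :=
          pick_of_notMem (by simp [captured_name])
        simp [Act.subst, Act.under, hx]
    simp [MixProc.subst, Val.subst_name, ha, ih]
  | par P Q ihP ihQ => simp [MixProc.subst, ihP, ihQ]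
  | res y z h P ih =>
    have hy : mixAvoid₁ .name y z P.fn = y := pick_of_notMem (by simp [captured_name])
    have hz : mixAvoid₂ .name y z P.fn = z :=
      pick_of_notMem (by simp [captured_name, hy, h.symm])
    simp [MixProc.subst, hy, hz, ih]
  | cond v P Q ihP ihQ => simp [MixProc.subst, Val.subst_name, ihP, ihQ]
  | inact => rfl

/-- A process agrees with its instances under a substitution of names. -/
theorem MixProc.rel_subst (P : MixProc) {σ : Name → Val} {ρ : Name → Name → Prop}
    (h : ∀ a ∈ P.fn, (Val.name a).Rel ρ (σ a)) : P.Rel ρ (P.subst σ) := by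
  have := (MixProc.Rel.refl P).subst (ρ := ρ) (σ := .name) (τ := σ)
    (by rintro a ha _ _ rfl; exact h a ha)
  rwa [MixProc.subst_name] at this

theorem MixProc.rel_subst1 {P : MixProc} {x x' : Name} (hx : x' ∉ P.fn.erase x) :
    P.Rel (extend Eq x x') (P.subst1 (.name x') x) := by
  refine P.rel_subst fun a ha => ?_
  by_cases hax : a = x
  · subst hax
    simp [Val.Rel, extend]
  · have : a ≠ x' := fun h => hx (h ▸ Finset.mem_erase.2 ⟨hax, ha⟩)
    simp [Val.Rel, extend, hax, this]

theorem MixProc.rel_rename2 {P : MixProc} {y z y' z' : Name} (h' : y' ≠ z')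
    (hy : y' ∉ (P.fn.erase y).erase z) (hz : z' ∉ (P.fn.erase y).erase z) :
    P.Rel (extend (extend Eq y y') z z') (P.rename2 y z y' z') := by
  refine P.rel_subst fun a ha => ?_
  by_cases haz : a = z
  · subst haz
    simp [Val.Rel, extend]
  · by_cases hay : a = y
    · subst hay
      simp [Val.Rel, extend, haz, h']
    · have h₁ : a ≠ y' := fun h => hy (h ▸ by simp [haz, hay, ha])
      have h₂ : a ≠ z' := fun h => hz (h ▸ by simp [haz, hay, ha])
      simp [Val.Rel, extend, hay, haz, h₁, h₂]

theorem MixProc.Rel.trans_eq {ρ : Name → Name → Prop} {P Q R : MixProc} (h : P.Rel ρ Q)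
    (h' : Q.Rel Eq R) : P.Rel ρ R := by
  simpa only [Relation.comp_eq] using h.trans h'

theorem MixProc.Rel.symm_eq {P Q : MixProc} (h : P.Rel Eq Q) : Q.Rel Eq P := by
  simpa only [eq_comm] using h.symm

theorem MixProc.Rel.eq_trans {ρ : Name → Name → Prop} {P Q R : MixProc} (h : P.Rel Eq Q)
    (h' : Q.Rel ρ R) : P.Rel ρ R := by
  simpa only [Relation.eq_comp] using h.trans h'

theorem MixProc.rel_alpha_res {P : MixProc} {y z y' z' : Name} (h : y ≠ z) (h' : y' ≠ z')
    (hy : y' ∉ (P.fn.erase y).erase z) (hz : z' ∉ (P.fn.erase y).erase z) :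
    (MixProc.res y z h P).Rel Eq (.res y' z' h' (P.rename2 y z y' z')) :=
  .res h h' (rel_rename2 h' hy hz)

theorem MixProc.rel_alpha_recv (q : Qual) (y : Val) {n : ℕ} (l : Fin (n + 1) → Label)
    (a : Fin (n + 1) → Act) (P : Fin (n + 1) → MixProc) (i : Fin (n + 1)) (x x' : Name)
    (ha : a i = .recv x) (hx : x' ∉ (P i).fn.erase x) :
    (MixProc.choice q y l a P).Rel Eq (.choice q y l (Function.update a i (.recv x'))
      (Function.update P i ((P i).subst1 (.name x') x))) := by
  have hr := MixProc.Rel.refl (.choice q y l a P)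
  cases hr with
  | choice _ _ hy hact hP =>
  refine .choice q l hy (fun j => ?_) (fun j => ?_)
  · by_cases hj : j = i
    · subst hj
      simp [ha, Act.Rel]
    · simpa [hj] using hact j
  · by_cases hj : j = i
    · subst hj
      simpa [ha, Act.extend] using rel_subst1 hx
    · simpa [hj] using hP j

/-- The endpoints bound by a restriction can be chosen outside any finite set. -/
theorem MixProc.exists_fresh_res {ρ : Name → Name → Prop} {y z y' z' : Name} {h : y ≠ z}
    {h' : y' ≠ z'} {P Q : MixProc} (hPQ : (MixProc.res y z h P).Rel ρ (.res y' z' h' Q))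
    (A : Finset Name) :
    ∃ (u v : Name) (huv : u ≠ v) (P' : MixProc), u ∉ A ∧ v ∉ A ∧
      MixSC (.res y z h P) (.res u v huv P') ∧ P'.Rel (extend (extend ρ u y') v z') Q := by
  obtain ⟨u, hu⟩ := Infinite.exists_notMem_finset (A ∪ P.fn)
  obtain ⟨v, hv⟩ := Infinite.exists_notMem_finset (insert u (A ∪ P.fn))
  simp only [Finset.mem_insert, Finset.mem_union, not_or] at hu hv
  have huv : u ≠ v := fun e => hv.1 e.symm
  have hu' : u ∉ (P.fn.erase y).erase z := by simp [hu]
  have hv' : v ∉ (P.fn.erase y).erase z := by simp [hv]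
  refine ⟨u, v, huv, P.rename2 y z u v, hu.1, hv.2.1, .alpha_res _ _ _ _ _ _ _ hu' hv', ?_⟩
  -- The renamed restriction is alpha-equivalent to the old one, hence still related to the right
  -- process.
  have := (rel_alpha_res h huv hu' hv').symm_eq.eq_trans hPQ
  cases this with
  | res _ _ hP => exact hP

/-! ## Transfer of structural congruence, reduction and barbs -/

/-- Distinctness on both sides excludes shadowing, so the order of the two binder pairs is
irrelevant. -/
theorem extend_extend_comm (ρ : Name → Name → Prop) {x x' y y' : Name} (h : x ≠ y)
    (h' : x' ≠ y') : extend (extend ρ x x') y y' = extend (extend ρ y y') x x' := by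
  funext a b
  simp only [extend, eq_iff_iff]
  grind

theorem MixProc.Rel.extend_of_notMem {ρ : Name → Name → Prop} {x x' : Name} {P Q : MixProc}
    (h : P.Rel ρ Q) (hx : x ∉ P.fn) (hx' : x' ∉ Q.fn) : P.Rel (extend ρ x x') Q :=
  h.mono fun a ha b hb hab => .inr ⟨fun e => hx (e ▸ ha), fun e => hx' (e ▸ hb), hab⟩

/-- A free occurrence of `x` would need a partner, and the only candidate is `x'`. -/
theorem MixProc.Rel.of_extend_of_notMem {ρ : Name → Name → Prop} {x x' : Name} {P Q : MixProc}
    (h : P.Rel (extend ρ x x') Q) (hx' : x' ∉ Q.fn) : x ∉ P.fn ∧ P.Rel ρ Q := by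
  have key : ∀ {a b : Name}, b ∈ Q.fn → extend ρ x x' a b → a ≠ x ∧ ρ a b := by
    rintro a b hb (⟨_, rfl⟩ | h)
    · exact (hx' hb).elim
    · exact ⟨h.1, h.2.2⟩
  refine ⟨fun hx => ?_, h.mono fun a _ b hb hab => (key hb hab).2⟩
  obtain ⟨b, hb, hab⟩ := h.exists_fn_right x hx
  exact (key hb hab).1 rfl

/-- Structural congruences of the right process can be followed by the left one. -/
def MixProc.Follows (U V : MixProc) : Prop :=
  ∀ ⦃ρ : Name → Name → Prop⦄ ⦃T : MixProc⦄, T.Rel ρ U → ∃ W, MixSC T W ∧ W.Rel ρ V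

theorem MixProc.follows_of_rel {U V : MixProc} (h : U.Rel Eq V) : U.Follows V :=
  fun _ T hT => ⟨T, .refl T, hT.trans_eq h⟩

theorem MixProc.Follows.choice (q : Qual) (y : Val) {n : ℕ} (l : Fin (n + 1) → Label)
    (a : Fin (n + 1) → Act) {P Q : Fin (n + 1) → MixProc} (h : ∀ i, (P i).Follows (Q i)) :
    (MixProc.choice q y l a P).Follows (.choice q y l a Q) := by
  intro ρ T hT
  cases hT with
  | choice _ _ hy ha hP =>
    choose W hW hWQ using fun i => h i (hP i)
    exact ⟨_, .congr_choice _ _ _ _ hW, .choice q l hy ha hWQ⟩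

theorem MixProc.Follows.par {P P' Q Q' : MixProc} (h₁ : P.Follows P') (h₂ : Q.Follows Q') :
    (MixProc.par P Q).Follows (.par P' Q') := by
  intro ρ T hT
  cases hT with
  | par hP hQ =>
    obtain ⟨_, s₁, r₁⟩ := h₁ hP
    obtain ⟨_, s₂, r₂⟩ := h₂ hQ
    exact ⟨_, .congr_par s₁ s₂, .par r₁ r₂⟩

theorem MixProc.Follows.res (y z : Name) (h : y ≠ z) {P P' : MixProc} (hP : P.Follows P') :
    (MixProc.res y z h P).Follows (.res y z h P') := by
  intro ρ T hT
  cases hT with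
  | res h₁ _ hT =>
    obtain ⟨_, s, r⟩ := hP hT
    exact ⟨_, .congr_res _ _ h₁ s, .res h₁ h r⟩

theorem MixProc.Follows.cond (v : Val) {P P' Q Q' : MixProc} (h₁ : P.Follows P')
    (h₂ : Q.Follows Q') : (MixProc.cond v P Q).Follows (.cond v P' Q') := by
  intro ρ T hT
  cases hT with
  | cond hv hP hQ =>
    obtain ⟨_, s₁, r₁⟩ := h₁ hP
    obtain ⟨_, s₂, r₂⟩ := h₂ hQ
    exact ⟨_, .congr_cond _ s₁ s₂, .cond hv r₁ r₂⟩

theorem MixProc.follows_reindex (q : Qual) (y : Val) {m n : ℕ} (e : Fin (m + 1) ≃ Fin (n + 1))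
    (l : Fin (n + 1) → Label) (a : Fin (n + 1) → Act) (P : Fin (n + 1) → MixProc) :
    (MixProc.choice q y l a P).Follows
      (.choice q y (fun i => l (e i)) (fun i => a (e i)) (fun i => P (e i))) := by
  intro ρ T hT
  cases hT with
  | choice _ _ hy ha hP =>
    exact ⟨_, .symm (.choice_reindex _ _ e _ _ _),
      .choice q _ hy (fun i => ha (e i)) (fun i => hP (e i))⟩

/-- On the left the inner binders may shadow the outer ones, so they are made fresh before the
exchange. -/
theorem MixProc.follows_res_comm (y z : Name) (h : y ≠ z) (y' z' : Name) (h' : y' ≠ z')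
    (P : MixProc) (h₁ : y ≠ y') (h₂ : y ≠ z') (h₃ : z ≠ y') (h₄ : z ≠ z') :
    (MixProc.res y z h (.res y' z' h' P)).Follows (.res y' z' h' (.res y z h P)) := by
  intro ρ T hT
  cases hT with
  | @res _ u v _ _ huv _ _ _ hT =>
  cases hT with
  | res hs _ hT =>
  obtain ⟨s, t, hst, Q, hs, ht, hsc, hQ⟩ := exists_fresh_res (.res hs h' hT) {u, v}
  simp only [Finset.mem_insert, Finset.mem_singleton, not_or] at hs ht
  refine ⟨_, .trans (.congr_res _ _ huv hsc) (.res_comm _ _ _ _ _ _ _ (Ne.symm hs.1)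
    (Ne.symm ht.1) (Ne.symm hs.2) (Ne.symm ht.2)), .res hst h' (.res huv h ?_)⟩
  rwa [extend_extend_comm _ (Ne.symm hs.2) h₃, extend_extend_comm _ (Ne.symm hs.1) h₁,
    extend_extend_comm _ (Ne.symm ht.2) h₄, extend_extend_comm _ (Ne.symm ht.1) h₂] at hQ

theorem MixProc.follows_par_res (y z : Name) (h : y ≠ z) (P Q : MixProc) (hy : y ∉ P.fn)
    (hz : z ∉ P.fn) :
    (MixProc.par P (.res y z h Q)).Follows (.res y z h (.par P Q)) := by
  intro ρ T hT
  cases hT with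
  | @par _ P' _ _ _ hP hT =>
  cases hT with
  | res hs _ hT =>
  obtain ⟨s, t, hst, Q', hs, ht, hsc, hQ⟩ := exists_fresh_res (.res hs h hT) P'.fn
  exact ⟨_, .trans (.congr_par (.refl _) hsc) (.par_res _ _ _ _ _ hs ht),
    .res hst h (.par ((hP.extend_of_notMem hs hy).extend_of_notMem ht hz) hQ)⟩

/-- Unlike the opposite direction, no renaming is needed: absence of the bound endpoints on the
right forces it on the left. -/
theorem MixProc.follows_res_par (y z : Name) (h : y ≠ z) (P Q : MixProc) (hy : y ∉ P.fn)
    (hz : z ∉ P.fn) :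
    (MixProc.res y z h (.par P Q)).Follows (.par P (.res y z h Q)) := by
  intro ρ T hT
  cases hT with
  | res hs _ hT =>
  cases hT with
  | par hP hQ =>
  obtain ⟨hv, hP⟩ := hP.of_extend_of_notMem hz
  obtain ⟨hu, hP⟩ := hP.of_extend_of_notMem hy
  exact ⟨_, .symm (.par_res _ _ _ _ _ hu hv), .par hP (.res hs h hQ)⟩

theorem MixProc.follows_res_swap (y z : Name) (h : y ≠ z) (P : MixProc) :
    (MixProc.res y z h P).Follows (.res z y h.symm P) := by
  intro ρ T hT
  cases hT with
  | res hs _ hT =>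
  rw [extend_extend_comm ρ hs h] at hT
  exact ⟨_, .res_swap _ _ _ _, .res hs.symm h.symm hT⟩

/-- Both directions are proved together because of the symmetry rule. -/
theorem MixSC.follows {U V : MixProc} (h : MixSC U V) : U.Follows V ∧ V.Follows U := by
  induction h with
  | refl P => exact ⟨MixProc.follows_of_rel (.refl P), MixProc.follows_of_rel (.refl P)⟩
  | symm _ ih => exact ih.symm
  | trans _ _ ih₁ ih₂ =>
    constructor
    · intro ρ T hT
      obtain ⟨W, s, hW⟩ := ih₁.1 hT
      obtain ⟨X, s', hX⟩ := ih₂.1 hW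
      exact ⟨X, s.trans s', hX⟩
    · intro ρ T hT
      obtain ⟨W, s, hW⟩ := ih₂.2 hT
      obtain ⟨X, s', hX⟩ := ih₁.2 hW
      exact ⟨X, s.trans s', hX⟩
  | congr_choice q y l a _ ih =>
    exact ⟨.choice q y l a fun i => (ih i).1, .choice q y l a fun i => (ih i).2⟩
  | congr_par _ _ ih₁ ih₂ => exact ⟨ih₁.1.par ih₂.1, ih₁.2.par ih₂.2⟩
  | congr_res y z h _ ih => exact ⟨.res y z h ih.1, .res y z h ih.2⟩
  | congr_cond v _ _ ih₁ ih₂ => exact ⟨.cond v ih₁.1 ih₂.1, .cond v ih₁.2 ih₂.2⟩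
  | choice_reindex q y e l a P =>
    refine ⟨?_, MixProc.follows_reindex q y e l a P⟩
    simpa using MixProc.follows_reindex q y e.symm (fun i => l (e i)) (fun i => a (e i))
      (fun i => P (e i))
  | alpha_res y z h y' z' h' P hy hz =>
    have := MixProc.rel_alpha_res h h' hy hz
    exact ⟨MixProc.follows_of_rel this, MixProc.follows_of_rel this.symm_eq⟩
  | alpha_recv q y l a P i x x' ha hx =>
    have := MixProc.rel_alpha_recv q y l a P i x x' ha hx
    exact ⟨MixProc.follows_of_rel this, MixProc.follows_of_rel this.symm_eq⟩
  | res_inact y z h =>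
    constructor
    · intro ρ T hT
      cases hT with
      | res h' _ hT =>
        cases hT
        exact ⟨_, .res_inact _ _ _, .inact⟩
    · intro ρ T hT
      cases hT
      exact ⟨_, .symm (.res_inact y z h), .res h h .inact⟩
  | res_comm y z h y' z' h' P h₁ h₂ h₃ h₄ =>
    exact ⟨MixProc.follows_res_comm y z h y' z' h' P h₁ h₂ h₃ h₄,
      MixProc.follows_res_comm y' z' h' y z h P h₁.symm h₃.symm h₂.symm h₄.symm⟩
  | par_res y z h P Q hy hz =>
    exact ⟨MixProc.follows_par_res y z h P Q hy hz, MixProc.follows_res_par y z h P Q hy hz⟩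
  | res_swap y z h P =>
    exact ⟨MixProc.follows_res_swap y z h P, MixProc.follows_res_swap z y h.symm P⟩
  | par_inact P =>
    constructor
    · intro ρ T hT
      cases hT with
      | par hP h₀ =>
        cases h₀
        exact ⟨_, .par_inact _, hP⟩
    · exact fun ρ T hT => ⟨_, .symm (.par_inact T), .par hT .inact⟩
  | par_comm P Q =>
    constructor <;>
    · intro ρ T hT
      cases hT with
      | par h₁ h₂ => exact ⟨_, .par_comm _ _, .par h₂ h₁⟩
  | par_assoc P Q R =>
    constructor
    · intro ρ T hT
      cases hT with
      | par h₁ h =>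
        cases h with
        | par h₂ h₃ => exact ⟨_, .par_assoc _ _ _, .par (.par h₁ h₂) h₃⟩
    · intro ρ T hT
      cases hT with
      | par h h₃ =>
        cases h with
        | par h₁ h₂ => exact ⟨_, .symm (.par_assoc _ _ _), .par h₁ (.par h₂ h₃)⟩

/-! ### Reflection of reductions and barbs -/

theorem MixProc.Rel.residue {ρ : Name → Name → Prop} {C D : MixProc} (h : C.Rel ρ D) (q : Qual) :
    (q.residue C).Rel ρ (q.residue D) := by
  cases q
  · exact .inact
  · exact h

/-- Reductions do not depend on the identity of free names: they are reflected along any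
relation on names. -/
theorem MixStep.reflect {U U' : MixProc} (h : MixStep U U') :
    ∀ {ρ : Name → Name → Prop} {T : MixProc}, T.Rel ρ U →
      ∃ T', MixStep T T' ∧ T'.Rel ρ U' := by
  induction h with
  | comm y z h q r l a P k b Q R i j v x ha hb hl =>
    intro ρ T hT
    cases hT with
    | @res _ y₁ z₁ _ _ h₁ _ _ _ hT =>
    cases hT with
    | par hT hR =>
    cases hT with
    | par hC hD =>
    have hC' := hC
    have hD' := hD
    cases hC with
    | @choice _ _ s _ _ _ a₁ _ P₁ _ hs ha₁ hP₁ =>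
    cases hD with
    | @choice _ _ t _ _ _ b₁ _ Q₁ _ ht hb₁ hQ₁ =>
    -- The decisive point: a bound endpoint is related only to its counterpart in the matching
    -- binder. The left choices thus sit on the two endpoints of one restriction, whatever `ρ` does
    -- to free names.
    have hs : s = .name y₁ := by
      cases s <;> simp_all [Val.Rel, extend]
    have ht : t = .name z₁ := by
      cases t <;> simp_all [Val.Rel, extend]
    subst hs ht
    have hai := ha₁ i
    have hPi := hP₁ i
    have hbj := hb₁ j
    have hQj := hQ₁ j
    rw [ha] at hai hPi
    rw [hb] at hbj hQj
    cases ha' : a₁ i with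
    | recv x => simp [ha', Act.Rel] at hai
    | send v₁ =>
    cases hb' : b₁ j with
    | send v => simp [hb', Act.Rel] at hbj
    | recv x₁ =>
    rw [ha'] at hai hPi
    rw [hb'] at hQj
    refine ⟨_, .comm y₁ z₁ h₁ q r l a₁ P₁ k b₁ Q₁ _ i j v₁ x₁ ha' hb' hl,
      .res h₁ h (.par (.par (.par hPi (hC'.residue q)) (.par (hQj.subst ?_) (hD'.residue r))) hR)⟩
    -- The two input binders receive the related payloads; all other names are left alone.
    rintro c _ d _ (⟨rfl, rfl⟩ | ⟨hc, hd, hcd⟩)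
    · simpa [Act.Rel] using hai
    · rw [Function.update_of_ne hc, Function.update_of_ne hd]
      exact hcd
  | cond_true P Q =>
    intro ρ T hT
    cases hT with
    | @cond _ v _ _ _ _ _ hv hP _ =>
      cases v <;> simp only [Val.Rel] at hv
      subst hv
      exact ⟨_, .cond_true _ _, hP⟩
  | cond_false P Q =>
    intro ρ T hT
    cases hT with
    | @cond _ v _ _ _ _ _ hv _ hQ =>
      cases v <;> simp only [Val.Rel] at hv
      subst hv
      exact ⟨_, .cond_false _ _, hQ⟩
  | par Q _ ih =>
    intro ρ T hT
    cases hT with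
    | par hP hQ =>
      obtain ⟨_, s, r⟩ := ih hP
      exact ⟨_, .par _ s, .par r hQ⟩
  | res y z h _ ih =>
    intro ρ T hT
    cases hT with
    | res h₁ _ hP =>
      obtain ⟨_, s, r⟩ := ih hP
      exact ⟨_, .res _ _ h₁ s, .res h₁ h r⟩
  | struct hs _ hs' ih =>
    intro ρ T hT
    obtain ⟨W, s₁, hW⟩ := hs.follows.1 hT
    obtain ⟨X, s₂, hX⟩ := ih hW
    obtain ⟨Y, s₃, hY⟩ := hs'.follows.1 hX
    exact ⟨Y, .struct s₁ s₂ s₃, hY⟩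

theorem MixProc.Rel.barb {ρ : Name → Name → Prop} {T U : MixProc} (h : T.Rel ρ U) :
    ∀ {u : Name}, U.barb u → ∃ t, ρ t u ∧ T.barb t := by
  induction h with
  | @choice ρ q y y' n l a a' P P' hy _ _ _ =>
    rintro u rfl
    cases y with
    | name t => exact ⟨t, hy, rfl⟩
    | bool b => exact hy.elim
    | unit => exact hy.elim
  | par _ _ ih₁ ih₂ =>
    rintro u (hu | hu)
    · obtain ⟨t, ht, hb⟩ := ih₁ hu
      exact ⟨t, ht, .inl hb⟩
    · obtain ⟨t, ht, hb⟩ := ih₂ hu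
      exact ⟨t, ht, .inr hb⟩
  | res h h' _ ih =>
    rintro u ⟨hu, hy, hz⟩
    obtain ⟨t, ht, hb⟩ := ih hu
    rcases ht with ht | ⟨h₁, _, ht | ⟨h₂, _, ht⟩⟩
    · exact (hz ht.2).elim
    · exact (hy ht.2).elim
    · exact ⟨t, ht, hb, h₂, h₁⟩
  | cond _ _ _ _ _ => exact fun h => h.elim
  | inact => exact fun h => h.elim

/-- A barb that is reached after a substitution of names stems from a barb that was reached
before. -/
theorem weakBarb_of_subst {T : MixProc} {σ : Name → Name} {u : Name}
    (h : mixCalculus.WeakBarb (mixCalculus.subst T σ) u) :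
    ∃ t, σ t = u ∧ mixCalculus.WeakBarb T t := by
  obtain ⟨U, hU, hb⟩ := h
  have key : ∃ T', mixCalculus.Steps T T' ∧ MixProc.Rel (fun a b => σ a = b) T' U := by
    clear hb
    induction hU with
    -- The starting relation is the graph of `σ`.
    | refl => exact ⟨T, .refl, MixProc.rel_subst T fun _ _ => rfl⟩
    | tail _ hs ih =>
      obtain ⟨T', hT, hr⟩ := ih
      obtain ⟨T'', hs', hr'⟩ := MixStep.reflect hs hr
      exact ⟨T'', hT.tail hs', hr'⟩
  obtain ⟨T', hT, hr⟩ := key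
  obtain ⟨t, ht, hb'⟩ := hr.barb hb
  exact ⟨t, ht, T', hT, hb'⟩

/-! ## The separation

Identifying the channels `0` and `1` of `0(4).3⟨2⟩ | 1⟨2⟩` creates a communication that unguards
the barb on `3`.  In mixed sessions the two parties of a communication are the endpoints of a
restricted channel, so that identifying free names creates no communication. -/

/-- The process `0(4).3⟨2⟩ | 1⟨2⟩`, whose two components use different channels. -/
def unconnected : PiProc :=
  .par (.sum (n := 1) (fun _ => .out 1 2) (fun _ => .zero))
    (.sum (n := 1) (fun _ => .inp 0 4)
      (fun _ => .sum (n := 1) (fun _ => .out 3 2) (fun _ => .zero)))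

theorem not_weakBarbOn_unconnected : ¬ piCalculus.WeakBarbOn unconnected 3 := by
  rintro ⟨b, hb, P, hP, hbP⟩
  -- Channel `1` is used only for output and channel `0` only for input, so no step exists and the
  -- initial barbs are the only ones.
  have hpol : unconnected.Polarized (fun x => x = 1) := by
    simp [unconnected, PiProc.Polarized, PiPrefix.HasPolarity]
  rcases Relation.ReflTransGen.cases_head hP with rfl | ⟨Q, hQ, _⟩
  · rcases hbP with ⟨_, h⟩ | ⟨_, h⟩
    all_goals
      simp only [PiPrefix.emits] at h
      subst h
      simp [piCalculus, PiBarb.chan] at hb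
  · exact PiStep.not_polarized hQ _ hpol

theorem weakBarbOn_connected :
    piCalculus.WeakBarbOn (unconnected.subst (Function.update id 1 0)) 3 := by
  refine ⟨.out 3, rfl, _, Relation.ReflTransGen.single
    -- Branches `0` and `0` meet on channel `0`, passing `2` to the binder `4`; the right component
    -- then offers the output on `3`.
    (PiStep.comm _ _ _ _ 0 0 0 2 4 rfl ?_), Or.inr ⟨0, ?_⟩⟩
  · rfl
  · rfl

end MixedSessions

theorem mainTheorem5 :
    ¬ ∃ (enc : MixedSessions.piCalculus.Proc → MixedSessions.mixCalculus.Proc)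
        (E : MixedSessions.mixCalculus.Proc → MixedSessions.mixCalculus.Proc → Prop),
      MixedSessions.IsGoodEncoding MixedSessions.piCalculus MixedSessions.mixCalculus enc E := by
  rintro ⟨enc, E, h⟩
  obtain ⟨_, rfl, hb⟩ := (h.barb_sensitive _ 3).1 MixedSessions.weakBarbOn_connected
  have hσ : {x | Function.update (id : MixedSessions.Name → MixedSessions.Name) 1 0 x ≠ x}.Finite :=
    (Set.finite_singleton 1).subset fun x hx => by
      by_contra hne
      exact hx (Function.update_of_ne hne _ _)
  have hE := h.name_invariant MixedSessions.unconnected _ hσ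
  obtain ⟨t, ht, hw⟩ := MixedSessions.weakBarb_of_subst ((h.bisimulation.barb _ _ hE _).1 hb)
  -- The substitution sends `1` to `0` and fixes every other name.
  have ht : t = 3 := by
    by_cases h1 : t = 1
    · subst h1
      simp at ht
    · simpa [h1] using ht
  subst ht
  exact MixedSessions.not_weakBarbOn_unconnected ((h.barb_sensitive _ 3).2 ⟨_, rfl, hw⟩)
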